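/- Let $G$ be a compact Lie group with normalised Haar measure $\mu$, acting continuously and transitively on a Hausdorff space $X$ with base point $x_0$ and stabiliser $H=G_{x_0}$ (so $X\cong G/H$). Let $\nu$ be the normalised Haar measure of $H$ and let $dx$ be the invariant measure $\int_X\phi\,dx=\int_G\tilde\phi\,d\mu$, where $\tilde\phi(g)=\phi(g\cdot x_0)$. Let $\widehat G$ be the set of equivalence classes of irreducible unitary representations $\pi:G\to U(d_\pi)$, and put $\hat f(\pi)=\int_G f(g)\pi(g)^*\,d\mu(g)$ for $f\in L^1(G)$; for functions $\phi$ on $X$ write $\hat\phi=\hat{\tilde\phi}$. Let $\widehat G_+\subset\widehat G$ be co-finite and let $p_t$ be a diffusive approximate identity with respect to $\widehat G_+$, that is, $p\in C^1((0,\infty);L^1(G))$, the operator norms $\|\hat p_t(\pi)\|$ are bounded uniformly in $\pi\in\widehat G$ and $t>0$, $\hat p_t(\pi)\to I$ as $t\to0$ for all $\pi\in\widehat G$, and for $\pi\in\widehat G_+$ moreover $\hat p_t(\pi)\to0$ as $t\to\infty$ and $-\partial_t\hat p_t(\pi)$ is positive semidefinite for all $t>0$. Let $L^2_0(G)=\bigoplus_{\pi\in\widehat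 G_+}\{g\mapsto\operatorname{tr}(\pi(g)A): A\in\mathbb C^{d_\pi\times d_\pi}\}$ (closed direct sum in $L^2(G)$) and $L^2_0(X)=\{\phi\in L^2(X):\tilde\phi\in L^2_0(G)\}$. Let $\alpha\ge0$ be a measurable weight on $\mathbb R_+=(0,\infty)$, and let $(\psi_\rho)_{\rho>0}\subset L^2(X)$, depending measurably on $\rho$, be a zonal diffusive wavelet family: each $\psi_\rho$ is $H$-invariant, and for every $t>0$ $$p_t^X\big|_{\widehat G_+}=\int_t^\infty\check\psi_\rho*\psi_\rho\;\alpha(\rho)\,d\rho,\qquad p_t^X(g\cdot x_0)=\int_H\int_H p_t(h_1gh_2)\,d\nu(h_1)\,d\nu(h_2).$$ Here $\check\psi_\rho(g\cdot x_0)=\overline{\psi_\rho(g^{-1}\cdot x_0)}$, $(\phi*\psi)(x)=\int_G\phi(g\cdot x_0)\psi(g^{-1}\cdot x)\,d\mu(g)$, and the identity is understood in the sense of Fourier series: for every irreducible $\pi$ the Fourier coefficients at $\pi$ of $\check\psi_\rho*\psi_\rho$ are integrable on $(t,\infty)$ with respect to $\alpha(\rho)\,d\rho$, and their integral is $\widehat{p_t^X}(\pi)$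 if $\pi\in\widehat G_+$ and $0$ otherwise. For $\phi\in L^2_0(X)$ and $\rho>0$, the function $(\phi\bullet\psi_\rho)(g)=\int_X\phi(x)\overline{\psi_\rho(g^{-1}\cdot x)}\,dx$ is constant on the cosets $gH$, hence defines a function $W_X\phi(\rho,\cdot)$ on $X$ by $W_X\phi(\rho,g\cdot x_0)=(\phi\bullet\psi_\rho)(g)$. The transform $\phi\mapsto W_X\phi$ is a linear isometry $$W_X:L^2_0(X)\to L^2(\mathbb R_+\times X,\ \alpha(\rho)\,d\rho\otimes dx),\qquad \langle W_X\phi_1,W_X\phi_2\rangle=\langle\phi_1,\phi_2\rangle,$$ i.e. it is unitary from $L^2_0(X)$ onto its (closed) range. -/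

import Mathlib

open MeasureTheory Set Filter Topology
open scoped ContDiff Manifold ComplexOrder

namespace DiffusiveWavelet

universe u v

/-- A (continuous, finite dimensional) irreducible unitary representation of `G` by unitary
matrices; irreducibility is expressed through the commutant. -/
structure IrrUnitaryRep (G : Type u) [Group G] [TopologicalSpace G] : Type u where
  /-- the dimension of the representation -/
  dim : ℕ
  dim_pos : 0 < dim
  /-- the underlying homomorphism into the unitary group -/
  toHom : G →* Matrix.unitaryGroup (Fin dim) ℂ
  continuous_toHom : Continuous toHom
  irreducible : ∀ A : Matrix (Fin dim) (Fin dim) ℂ,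
    (∀ g : G, (toHom g : Matrix (Fin dim) (Fin dim) ℂ) * A = A * (toHom g).1) →
      ∃ c : ℂ, A = c • (1 : Matrix (Fin dim) (Fin dim) ℂ)

section Group

variable {G : Type u} [Group G] [TopologicalSpace G]

/-- The matrix `π(g)`. -/
def IrrUnitaryRep.mat (π : IrrUnitaryRep G) (g : G) : Matrix (Fin π.dim) (Fin π.dim) ℂ :=
  (π.toHom g).1

/-- Equivalence of representations: there is an invertible intertwining matrix. -/
def IrrUnitaryRep.Equivalent (π σ : IrrUnitaryRep G) : Prop :=
  ∃ (A : Matrix (Fin π.dim) (Fin σ.dim) ℂ) (B : Matrix (Fin σ.dim) (Fin π.dim) ℂ),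
    A * B = 1 ∧ B * A = 1 ∧ ∀ g : G, π.mat g * A = A * σ.mat g

/-- Equivalence of irreducible unitary representations as a setoid. -/
def irrSetoid (G : Type u) [Group G] [TopologicalSpace G] : Setoid (IrrUnitaryRep G) where
  r := IrrUnitaryRep.Equivalent
  iseqv :=
    { refl := fun π => ⟨1, 1, by simp, by simp, by simp⟩
      symm := by
        rintro π σ ⟨A, B, hAB, hBA, h⟩
        refine ⟨B, A, hBA, hAB, fun g => ?_⟩
        calc σ.mat g * B = (B * A) * σ.mat g * B := by rw [hBA, Matrix.one_mul]
          _ = B * (A * σ.mat g) * B := by rw [Matrix.mul_assoc B A]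
          _ = B * (π.mat g * A) * B := by rw [h g]
          _ = B * π.mat g * (A * B) := by simp only [Matrix.mul_assoc]
          _ = B * π.mat g := by rw [hAB, Matrix.mul_one]
      trans := by
        rintro π σ τ ⟨A, B, hAB, hBA, h⟩ ⟨C, D, hCD, hDC, h'⟩
        refine ⟨A * C, D * B, ?_, ?_, fun g => ?_⟩
        · calc A * C * (D * B) = A * (C * D) * B := by simp only [Matrix.mul_assoc]
            _ = 1 := by rw [hCD, Matrix.mul_one, hAB]
        · calc D * B * (A * C) = D * (B * A) * C := by simp only [Matrix.mul_assoc]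
            _ = 1 := by rw [hBA, Matrix.mul_one, hDC]
        · calc π.mat g * (A * C) = (π.mat g * A) * C := by rw [Matrix.mul_assoc]
            _ = A * (σ.mat g * C) := by rw [h g, Matrix.mul_assoc]
            _ = A * C * τ.mat g := by rw [h' g, Matrix.mul_assoc] }

/-- The unitary dual: the set of equivalence classes of irreducible unitary representations. -/
def UnitaryDual (G : Type u) [Group G] [TopologicalSpace G] : Type u :=
  Quotient (irrSetoid G)

/-- The equivalence class of an irreducible representation. -/
def IrrUnitaryRep.cls (π : IrrUnitaryRep G) : UnitaryDual G :=
  Quotient.mk (irrSetoid G) π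

variable [MeasurableSpace G]

/-- The Fourier coefficient `∫ f(g) π(g)^* dμ(g)`, computed entrywise. -/
noncomputable def fourierCoeff (μ : Measure G) (f : G → ℂ) (π : IrrUnitaryRep G) :
    Matrix (Fin π.dim) (Fin π.dim) ℂ :=
  Matrix.of fun i j => ∫ g, f g * (π.mat g).conjTranspose i j ∂μ

/-- Diffusive approximate identity with respect to a co-finite set `S` of classes in the dual.
The norm in `bounded` is the operator norm for the Euclidean norm on `ℂ^d`. -/
structure IsDiffusiveApproxIdentity (μ : Measure G) (S : Set (UnitaryDual G))
    (p : ℝ → Lp ℂ 1 μ) : Prop where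
  cofinite : Sᶜ.Finite
  contDiff : ContDiffOn ℝ 1 p (Ioi 0)
  bounded : ∃ C : ℝ, ∀ π : IrrUnitaryRep G, ∀ t : ℝ, 0 < t →
    ‖Matrix.toEuclideanCLM (𝕜 := ℂ) (fourierCoeff μ (p t) π)‖ ≤ C
  tendsto_one : ∀ π : IrrUnitaryRep G,
    Tendsto (fun t : ℝ => fourierCoeff μ (p t) π) (𝓝[>] 0) (𝓝 1)
  tendsto_zero : ∀ π : IrrUnitaryRep G, π.cls ∈ S →
    Tendsto (fun t : ℝ => fourierCoeff μ (p t) π) atTop (𝓝 0)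
  posSemidef : ∀ π : IrrUnitaryRep G, π.cls ∈ S → ∀ t : ℝ, 0 < t →
    (-(Matrix.of fun i j => deriv (fun s : ℝ => fourierCoeff μ (p s) π i j) t)).PosSemidef

/-- The closed subspace `⊕_{π ∈ S} H_π` of `L²(G)`, where `H_π = {g ↦ tr (π(g) A)}`. -/
noncomputable def L2ZeroGroup (μ : Measure G) (S : Set (UnitaryDual G)) :
    Submodule ℂ (Lp ℂ 2 μ) :=
  (Submodule.span ℂ {f : Lp ℂ 2 μ | ∃ π : IrrUnitaryRep G, π.cls ∈ S ∧
    ∃ A : Matrix (Fin π.dim) (Fin π.dim) ℂ,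
      (f : G → ℂ) =ᵐ[μ] fun g => (π.mat g * A).trace}).topologicalClosure

/-- The involution `f ↦ conj (f (g⁻¹))` of functions on the group. -/
noncomputable def involution (f : G → ℂ) : G → ℂ := fun g => (starRingEnd ℂ) (f g⁻¹)

end Group

section HomogeneousSpace

variable {G : Type u} [Group G] [TopologicalSpace G] [MeasurableSpace G] [BorelSpace G]
variable {X : Type v} [TopologicalSpace X] [MeasurableSpace X] [BorelSpace X] [MulAction G X]

/-- The lift `g ↦ φ (g • x₀)` to `G` of a function on the homogeneous space. -/
def lift (x₀ : X) (φ : X → ℂ) : G → ℂ := fun g => φ (g • x₀)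

/-- The invariant measure `dx`, characterised by `∫ φ(x) dx = ∫ φ(g • x₀) dμ(g)`. -/
noncomputable def invMeasure (μ : Measure G) (x₀ : X) : Measure X :=
  μ.map fun g => g • x₀

theorem measurePreserving_orbit [ContinuousSMul G X] (μ : Measure G) (x₀ : X) :
    MeasurePreserving (fun g : G => g • x₀) μ (invMeasure μ x₀) :=
  ⟨(continuous_id.smul continuous_const).measurable, rfl⟩

/-- `L²_0(X)`: the functions in `L²(X)` whose lift belongs to `⊕_{π ∈ S} H_π`. -/
noncomputable def L2ZeroSpace [ContinuousSMul G X] (μ : Measure G) (x₀ : X)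
    (S : Set (UnitaryDual G)) : Submodule ℂ (Lp ℂ 2 (invMeasure μ x₀)) :=
  (L2ZeroGroup μ S).comap
    (Lp.compMeasurePreservingₗᵢ ℂ (fun g : G => g • x₀)
      (measurePreserving_orbit μ x₀)).toLinearMap

/-- A function (class) on `X` is zonal if it is invariant under the stabiliser of `x₀`. -/
def IsZonal (μ : Measure G) (x₀ : X) (φ : X → ℂ) : Prop :=
  ∀ h ∈ MulAction.stabilizer G x₀, (fun x => φ (h • x)) =ᵐ[invMeasure μ x₀] φ

/-- The group convolution `(φ * ψ)(x) = ∫ φ(g • x₀) ψ(g⁻¹ • x) dμ(g)` on `X`. It depends on its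
first factor only through the lift `a` of that factor, which is taken as the argument. -/
noncomputable def conv (μ : Measure G) (a : G → ℂ) (ψ : X → ℂ) : X → ℂ :=
  fun x => ∫ g, a g * ψ (g⁻¹ • x) ∂μ

/-- `ψˇ * ψ` for a zonal `ψ`, where `ψˇ` is the function on `X` whose lift is the involution of
the lift of `ψ`. -/
noncomputable def selfConv (μ : Measure G) (x₀ : X) (ψ : X → ℂ) : X → ℂ :=
  conv μ (involution (lift x₀ ψ)) ψ

/-- The lift to `G` of the zonal average `p^X` of a function `p` on `G`,
`p^X (g • x₀) = ∫_H ∫_H p (h₁ g h₂) dν(h₁) dν(h₂)`, with `H` the stabiliser of `x₀`. -/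
noncomputable def zonalAverageLift (x₀ : X) (ν : Measure (MulAction.stabilizer G x₀))
    (p : G → ℂ) : G → ℂ :=
  fun g => ∫ h₂, ∫ h₁, p ((h₁ : G) * g * (h₂ : G)) ∂ν ∂ν

/-- Zonal diffusive wavelet family. The admissibility condition
`p_t^X |_S = ∫_t^∞ (ψ_ρˇ * ψ_ρ) α(ρ) dρ` is an identity between (distributional) Fourier series
and is read weakly, i.e. tested against all matrix coefficients: the restriction to `S` keeps the
Fourier coefficients of `p_t^X` for classes in `S` and replaces the others by zero. -/
structure IsZonalWaveletFamily (μ : Measure G) (x₀ : X)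
    (ν : Measure (MulAction.stabilizer G x₀)) (S : Set (UnitaryDual G)) (p : ℝ → Lp ℂ 1 μ)
    (α : ℝ → ℝ) (ψ : ℝ → Lp ℂ 2 (invMeasure μ x₀)) : Prop where
  zonal : ∀ ρ : ℝ, 0 < ρ → IsZonal μ x₀ (ψ ρ)
  integrable : ∀ t : ℝ, 0 < t → ∀ (π : IrrUnitaryRep G) (i j : Fin π.dim),
    IntegrableOn (fun ρ : ℝ =>
      fourierCoeff μ (lift x₀ (selfConv μ x₀ (ψ ρ))) π i j * (α ρ : ℂ)) (Ioi t)
  admissible : ∀ t : ℝ, 0 < t → ∀ π : IrrUnitaryRep G, π.cls ∈ S → ∀ i j : Fin π.dim,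
    fourierCoeff μ (zonalAverageLift x₀ ν (p t)) π i j =
      ∫ ρ in Ioi t, fourierCoeff μ (lift x₀ (selfConv μ x₀ (ψ ρ))) π i j * (α ρ : ℂ)
  admissible_compl : ∀ t : ℝ, 0 < t → ∀ π : IrrUnitaryRep G, π.cls ∉ S → ∀ i j : Fin π.dim,
    0 = ∫ ρ in Ioi t, fourierCoeff μ (lift x₀ (selfConv μ x₀ (ψ ρ))) π i j * (α ρ : ℂ)

/-- The product `(φ • ψ)(g) = ∫ φ(x) conj (ψ(g⁻¹ • x)) dx`, a function on `G`. -/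
noncomputable def bullet (μ : Measure G) (x₀ : X) (φ ψ : X → ℂ) : G → ℂ :=
  fun g => ∫ x, φ x * (starRingEnd ℂ) (ψ (g⁻¹ • x)) ∂(invMeasure μ x₀)

/-- The wavelet transform `W φ (ρ, x) = (φ • ψ_ρ)(x)`: the value of `φ • ψ_ρ` at any `g` with
`g • x₀ = x` (for zonal `ψ_ρ` the choice does not matter). -/
noncomputable def waveletTransform [MulAction.IsPretransitive G X] (μ : Measure G) (x₀ : X)
    (ψ : ℝ → Lp ℂ 2 (invMeasure μ x₀)) (φ : X → ℂ) : ℝ × X → ℂ :=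
  fun z => bullet μ x₀ φ (ψ z.1) (Classical.choose (MulAction.exists_smul_eq G x₀ z.2))

end HomogeneousSpace

/-- The measure `α(ρ) dρ` on the half-line `(0, ∞)`. -/
noncomputable def scaleMeasure (α : ℝ → ℝ) : Measure ℝ :=
  (volume.restrict (Ioi 0)).withDensity fun ρ => ENNReal.ofReal (α ρ)

end DiffusiveWavelet

/-!
On `L²(G)` let `V_ρ f = f • w_ρ`, where `w_ρ` is the lift of `ψ_ρ`. This operator sends a matrix
coefficient `tr (π(·) A)` to `tr (π(·) ŵ_ρ(π)ᴴ A)`, so for such `f` the product `⟪V_ρ f', V_ρ f⟫` is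
linear in the Fourier coefficient `ŵ_ρ(π) ŵ_ρ(π)ᴴ` of `ψ_ρˇ * ψ_ρ`. Integrated over `ρ > t` the
latter becomes `P p̂_t(π) P` by admissibility, where `P` is the mean of `π` over the stabiliser `H`.
As `t → 0` this leaves `∫ ⟪V_ρ f', V_ρ f⟫ α(ρ) dρ = ⟪f', T f⟫`, where `T` averages twice over `H`.
The resulting identity `‖V f‖² = ⟪f, T f⟫` passes from the span of the coefficients to its closure,
by Fatou's lemma in one direction and the triangle inequality in the other, and `T` fixes all lifts
of functions on `X`.
-/

namespace DiffusiveWavelet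

open scoped ENNReal InnerProductSpace

section WeakGram

variable {E F : Type*} [NormedAddCommGroup E] [InnerProductSpace ℂ E]
  [NormedAddCommGroup F] [InnerProductSpace ℂ F]
  {s : Measure ℝ} {V : ℝ → E →L[ℂ] F} {T : E →L[ℂ] E} {f : E}

/-- The vectors `f` on which the Gram operator `∫ V_ρ^* V_ρ ds(ρ)` of an operator family is defined
weakly, as an improper integral at `0`, and agrees with `T`. -/
def weakGramLimit (s : Measure ℝ) (V : ℝ → E →L[ℂ] F) (T : E →L[ℂ] E) : Submodule ℂ E where
  carrier := {f | ∀ f', (∀ t, 0 < t → IntegrableOn (fun ρ => ⟪V ρ f', V ρ f⟫_ℂ) (Ioi t) s) ∧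
    Tendsto (fun t => ∫ ρ in Ioi t, ⟪V ρ f', V ρ f⟫_ℂ ∂s) (𝓝[>] 0) (𝓝 ⟪f', T f⟫_ℂ)}
  zero_mem' f' := by simp
  add_mem' {f₁ f₂} h₁ h₂ f' := by
    obtain ⟨hi₁, hl₁⟩ := h₁ f'
    obtain ⟨hi₂, hl₂⟩ := h₂ f'
    simp only [map_add, inner_add_right]
    refine ⟨fun t ht => (hi₁ t ht).add (hi₂ t ht), (hl₁.add hl₂).congr' ?_⟩
    filter_upwards [self_mem_nhdsWithin] with t ht
    exact (integral_add (hi₁ t ht) (hi₂ t ht)).symm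
  smul_mem' c f h f' := by
    obtain ⟨hi, hl⟩ := h f'
    simp only [map_smul, inner_smul_right, integral_const_mul]
    exact ⟨fun t ht => (hi t ht).const_mul c, hl.const_mul c⟩

theorem eLpNorm_of_mem_weakGramLimit (hs : ∀ᵐ ρ ∂s, 0 < ρ) (hf : f ∈ weakGramLimit s V T)
    (hm : AEStronglyMeasurable (fun ρ => V ρ f) s) :
    eLpNorm (fun ρ => V ρ f) 2 s = ENNReal.ofReal √(inner ℂ f (T f)).re := by
  obtain ⟨hi, hl⟩ := hf f
  have hcover : AECover s (𝓝[>] 0) fun t : ℝ => Ioi t :=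
    ⟨hs.mono fun ρ hρ => mem_nhdsWithin_of_mem_nhds (eventually_lt_nhds hρ),
      fun _ => measurableSet_Ioi⟩
  have htail : ∀ t : ℝ, 0 < t →
      ∫⁻ ρ in Ioi t, ‖V ρ f‖ₑ ^ 2 ∂s = ENNReal.ofReal (∫ ρ in Ioi t, ⟪V ρ f, V ρ f⟫_ℂ ∂s).re := by
    intro t ht
    have hre : (∫ ρ in Ioi t, ⟪V ρ f, V ρ f⟫_ℂ ∂s).re = ∫ ρ in Ioi t, ‖V ρ f‖ ^ 2 ∂s := by
      refine (integral_re (hi t ht)).symm.trans (integral_congr_ae (ae_of_all _ fun ρ => ?_))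
      exact inner_self_eq_norm_sq (𝕜 := ℂ) _
    have hint : IntegrableOn (fun ρ => ‖V ρ f‖ ^ 2) (Ioi t) s :=
      (hi t ht).re.congr (ae_of_all _ fun ρ => inner_self_eq_norm_sq (𝕜 := ℂ) _)
    rw [hre, ofReal_integral_eq_lintegral_ofReal hint (ae_of_all _ fun _ => by positivity)]
    simp only [ENNReal.ofReal_pow (norm_nonneg _), ofReal_norm]
  have hlim : ∫⁻ ρ, ‖V ρ f‖ₑ ^ 2 ∂s = ENNReal.ofReal (inner ℂ f (T f)).re :=
    hcover.lintegral_eq_of_tendsto _ (hm.enorm.pow_const 2)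
      ((ENNReal.tendsto_ofReal ((Complex.continuous_re.tendsto _).comp hl)).congr'
        (eventually_mem_nhdsWithin.mono fun t ht => (htail t ht).symm))
  have hsq : eLpNorm (fun ρ => V ρ f) 2 s ^ 2 = ENNReal.ofReal √(inner ℂ f (T f)).re ^ 2 := by
    rw [← ENNReal.ofReal_pow (Real.sqrt_nonneg _), Real.sq_sqrt', ENNReal.ofReal_max, ← hlim]
    simpa using eLpNorm_nnreal_pow_eq_lintegral (p := 2) (f := fun ρ => V ρ f) (μ := s) two_ne_zero
  exact (ENNReal.pow_right_strictMono two_ne_zero).injective hsq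

theorem continuous_ofReal_sqrt_re_inner (T : E →L[ℂ] E) :
    Continuous fun f => ENNReal.ofReal √(inner ℂ f (T f)).re :=
  ENNReal.continuous_ofReal.comp (by fun_prop)

theorem eLpNorm_le_of_mem_closure {K : Submodule ℂ E} (hs : ∀ᵐ ρ ∂s, 0 < ρ)
    (hK : K ≤ weakGramLimit s V T) (hm : ∀ f, AEStronglyMeasurable (fun ρ => V ρ f) s)
    (hf : f ∈ K.topologicalClosure) :
    eLpNorm (fun ρ => V ρ f) 2 s ≤ ENNReal.ofReal √(inner ℂ f (T f)).re := by
  obtain ⟨u, hu, hlim⟩ := mem_closure_iff_seq_limit.mp hf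
  have hQ : Tendsto (fun n => ENNReal.ofReal √(inner ℂ (u n) (T (u n))).re) atTop
      (𝓝 (ENNReal.ofReal √(inner ℂ f (T f)).re)) :=
    ((continuous_ofReal_sqrt_re_inner T).tendsto f).comp hlim
  calc eLpNorm (fun ρ => V ρ f) 2 s
      ≤ liminf (fun n => eLpNorm (fun ρ => V ρ (u n)) 2 s) atTop :=
        Lp.eLpNorm_lim_le_liminf_eLpNorm (fun n => hm (u n)) _
          (ae_of_all _ fun ρ => ((V ρ).continuous.tendsto f).comp hlim)
    _ = ENNReal.ofReal √(inner ℂ f (T f)).re := by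
        simp only [fun n => eLpNorm_of_mem_weakGramLimit hs (hK (hu n)) (hm (u n))]
        exact hQ.liminf_eq

theorem eLpNorm_of_mem_closure {K : Submodule ℂ E} (hs : ∀ᵐ ρ ∂s, 0 < ρ)
    (hK : K ≤ weakGramLimit s V T) (hm : ∀ f, AEStronglyMeasurable (fun ρ => V ρ f) s)
    (hf : f ∈ K.topologicalClosure) :
    eLpNorm (fun ρ => V ρ f) 2 s = ENNReal.ofReal √(inner ℂ f (T f)).re := by
  refine (eLpNorm_le_of_mem_closure hs hK hm hf).antisymm ?_
  obtain ⟨u, hu, hlim⟩ := mem_closure_iff_seq_limit.mp hf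
  have hQ := continuous_ofReal_sqrt_re_inner T
  have hsub : Tendsto (fun n => u n - f) atTop (𝓝 0) := by simpa using hlim.sub_const f
  have hsplit : ∀ n, ENNReal.ofReal √(inner ℂ (u n) (T (u n))).re ≤ eLpNorm (fun ρ => V ρ f) 2 s +
      ENNReal.ofReal √(inner ℂ (u n - f) (T (u n - f))).re := by
    intro n
    have hmem : u n - f ∈ K.topologicalClosure := sub_mem (K.le_topologicalClosure (hu n)) hf
    calc ENNReal.ofReal √(inner ℂ (u n) (T (u n))).re
        = eLpNorm ((fun ρ => V ρ f) + fun ρ => V ρ (u n - f)) 2 s := by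
          rw [← eLpNorm_of_mem_weakGramLimit hs (hK (hu n)) (hm (u n))]
          exact congrArg (eLpNorm · 2 s) (funext fun ρ => by simp)
      _ ≤ eLpNorm (fun ρ => V ρ f) 2 s + eLpNorm (fun ρ => V ρ (u n - f)) 2 s :=
          eLpNorm_add_le (hm f) (hm _) one_le_two
      _ ≤ _ := add_le_add_right (eLpNorm_le_of_mem_closure hs hK hm hmem) _
  simpa using le_of_tendsto_of_tendsto' ((hQ.tendsto f).comp hlim)
    (((hQ.tendsto 0).comp hsub).const_add (eLpNorm (fun ρ => V ρ f) 2 s)) hsplit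

theorem eLpNorm_eq_enorm_of_mem_closure {K : Submodule ℂ E} (hs : ∀ᵐ ρ ∂s, 0 < ρ)
    (hK : K ≤ weakGramLimit s V T) (hm : ∀ f, AEStronglyMeasurable (fun ρ => V ρ f) s)
    (hf : f ∈ K.topologicalClosure) (hT : T f = f) : eLpNorm (fun ρ => V ρ f) 2 s = ‖f‖ₑ := by
  rw [eLpNorm_of_mem_closure hs hK hm hf, hT, ← ofReal_norm, norm_eq_sqrt_re_inner (𝕜 := ℂ) f]
  rfl

end WeakGram

section LpSpaces

variable {Y : Type*} [MeasurableSpace Y] {s : Measure ℝ} {m : Measure Y}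

theorem exists_linearIsometry_Lp {𝕜 E F : Type*} [NormedRing 𝕜] [SeminormedAddCommGroup E]
    [Module 𝕜 E] [NormedAddCommGroup F] [Module 𝕜 F] [IsBoundedSMul 𝕜 F] {p : ℝ≥0∞}
    [Fact (1 ≤ p)] (Φ : E →ₗ[𝕜] Y → F) (hm : ∀ f, AEStronglyMeasurable (Φ f) m)
    (hΦ : ∀ f, eLpNorm (Φ f) p m = ‖f‖ₑ) : ∃ W : E →ₗᵢ[𝕜] Lp F p m, ∀ f, W f =ᵐ[m] Φ f := by
  have hmem : ∀ f, MemLp (Φ f) p m := fun f => ⟨hm f, (hΦ f).trans_lt enorm_lt_top⟩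
  refine ⟨⟨⟨⟨fun f => (hmem f).toLp (Φ f), fun f g => ?_⟩, fun c f => ?_⟩, fun f => ?_⟩,
    fun f => (hmem f).coeFn_toLp⟩
  · simp only [map_add]
    rfl
  · simp only [map_smul]
    rfl
  · exact (Lp.norm_toLp _ (hmem f)).trans (by rw [hΦ, toReal_enorm])

variable [TopologicalSpace Y] [TopologicalSpace.PseudoMetrizableSpace Y] [CompactSpace Y]
  [SecondCountableTopology Y] [BorelSpace Y]

theorem aestronglyMeasurable_uncurry_continuousMap {U : ℝ → C(Y, ℂ)}
    (hU : AEStronglyMeasurable U s) :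
    AEStronglyMeasurable (fun z : ℝ × Y => U z.1 z.2) (s.prod m) := by
  have hpair : AEStronglyMeasurable (fun z : ℝ × Y => (U z.1, z.2)) (s.prod m) :=
    hU.comp_fst.prodMk measurable_snd.aestronglyMeasurable
  exact continuous_eval.comp_aestronglyMeasurable hpair

theorem eLpNorm_uncurry_continuousMap {U : ℝ → C(Y, ℂ)} (hU : AEStronglyMeasurable U s)
    [IsFiniteMeasure m] :
    eLpNorm (fun z : ℝ × Y => U z.1 z.2) 2 (s.prod m) =
      eLpNorm (fun ρ => ContinuousMap.toLp 2 m ℂ (U ρ)) 2 s := by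
  have hslice : ∀ ρ, ‖ContinuousMap.toLp 2 m ℂ (U ρ)‖ₑ ^ (2 : ℝ) = ∫⁻ y, ‖U ρ y‖ₑ ^ (2 : ℝ) ∂m := by
    intro ρ
    rw [Lp.enorm_def, eLpNorm_congr_ae (ContinuousMap.coeFn_toLp m (U ρ))]
    simpa using eLpNorm_nnreal_pow_eq_lintegral (p := 2) (f := U ρ) (μ := m) two_ne_zero
  simp only [eLpNorm_eq_lintegral_rpow_enorm_toReal two_ne_zero ENNReal.ofNat_ne_top,
    ENNReal.toReal_ofNat, hslice]
  rw [lintegral_prod _ ((aestronglyMeasurable_uncurry_continuousMap hU).enorm.pow_const 2)]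

end LpSpaces

section TraceIntegral

variable {Y n : Type*} [MeasurableSpace Y] [Fintype n] {κ : Measure Y} {M : Y → Matrix n n ℂ}

theorem integrable_trace_mul (hM : ∀ i j, Integrable (fun y => M y i j) κ) (C : Matrix n n ℂ) :
    Integrable (fun y => (C * M y).trace) κ := by
  simp only [Matrix.trace, Matrix.diag, Matrix.mul_apply]
  exact integrable_finsetSum _ fun i _ => integrable_finsetSum _ fun j _ => (hM j i).const_mul _

theorem integral_trace_mul (hM : ∀ i j, Integrable (fun y => M y i j) κ) (C : Matrix n n ℂ) :
    ∫ y, (C * M y).trace ∂κ = (C * Matrix.of fun i j => ∫ y, M y i j ∂κ).trace := by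
  simp only [Matrix.trace, Matrix.diag, Matrix.mul_apply, Matrix.of_apply]
  rw [integral_finsetSum]
  · refine Finset.sum_congr rfl fun i _ => ?_
    rw [integral_finsetSum _ fun j _ => (hM j i).const_mul _]
    simp only [integral_const_mul]
  · exact fun i _ => integrable_finsetSum _ fun j _ => (hM j i).const_mul _

end TraceIntegral

namespace IrrUnitaryRep

variable {G : Type*} [Group G] [TopologicalSpace G] (π : IrrUnitaryRep G)

theorem mat_mul (g h : G) : π.mat (g * h) = π.mat g * π.mat h := by
  simp [mat]

theorem mat_inv (g : G) : π.mat g⁻¹ = (π.mat g).conjTranspose := by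
  simp [mat, Matrix.star_eq_conjTranspose]

theorem continuous_mat : Continuous π.mat :=
  continuous_subtype_val.comp π.continuous_toHom

variable [MeasurableSpace G] [OpensMeasurableSpace G] {Y : Type*} [MeasurableSpace Y]
  {κ : Measure Y} {f : Y → ℂ} {c : Y → G}

theorem integrable_smul_mat (hf : Integrable f κ) (hc : Measurable c) (i j : Fin π.dim) :
    Integrable (fun y => (f y • π.mat (c y)) i j) κ :=
  hf.mul_bdd (c := 1)
    ((π.continuous_mat.matrix_elem i j).measurable.comp hc).aestronglyMeasurable
    (ae_of_all _ fun y => entry_norm_bound_of_unitary (π.toHom (c y)).2 i j)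

theorem integrable_mul_trace (hf : Integrable f κ) (hc : Measurable c)
    (C : Matrix (Fin π.dim) (Fin π.dim) ℂ) :
    Integrable (fun y => f y * (C * π.mat (c y)).trace) κ := by
  simpa only [Matrix.mul_smul, Matrix.trace_smul, smul_eq_mul] using
    integrable_trace_mul (π.integrable_smul_mat hf hc) C

end IrrUnitaryRep

section CompactGroup

variable {G : Type*} [Group G] [TopologicalSpace G] [IsTopologicalGroup G] [CompactSpace G]
  [MeasurableSpace G] [BorelSpace G] (μ : Measure G) [μ.IsHaarMeasure] [IsProbabilityMeasure μ]

instance (priority := 50) isMulRightInvariant_of_compactSpace : μ.IsMulRightInvariant := by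
  refine ⟨fun g => ?_⟩
  have : IsProbabilityMeasure (μ.map (· * g)) :=
    Measure.isProbabilityMeasure_map (measurable_mul_const g).aemeasurable
  exact Measure.isHaarMeasure_eq_of_isProbabilityMeasure _ _

instance (priority := 50) isInvInvariant_of_compactSpace : μ.IsInvInvariant := by
  have : IsProbabilityMeasure μ.inv := Measure.isProbabilityMeasure_map measurable_inv.aemeasurable
  have : μ.inv.IsHaarMeasure := { }
  exact ⟨Measure.isHaarMeasure_eq_of_isProbabilityMeasure _ _⟩

end CompactGroup

section FourierCoefficients

variable {G : Type*} [Group G] [TopologicalSpace G] [MeasurableSpace G] {μ : Measure G}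
  {f : G → ℂ} (π : IrrUnitaryRep G)

theorem fourierCoeff_congr_ae {f' : G → ℂ} (h : f =ᵐ[μ] f') :
    fourierCoeff μ f π = fourierCoeff μ f' π := by
  ext i j
  exact integral_congr_ae (h.mono fun g hg => by simp only [hg])

theorem fourierCoeff_const_mul (c : ℂ) (f : G → ℂ) :
    fourierCoeff μ (fun g => c * f g) π = c • fourierCoeff μ f π := by
  ext i j
  simp only [fourierCoeff, Matrix.of_apply, Matrix.smul_apply, mul_assoc, integral_const_mul,
    smul_eq_mul]

variable [IsTopologicalGroup G] [BorelSpace G]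

theorem integrable_involution [μ.IsInvInvariant] (hf : Integrable f μ) :
    Integrable (involution f) μ :=
  RCLike.conjCLE.toContinuousLinearMap.integrable_comp hf.comp_inv

theorem fourierCoeff_involution [μ.IsInvInvariant] (f : G → ℂ) :
    fourierCoeff μ (involution f) π = (fourierCoeff μ f π).conjTranspose := by
  ext i j
  rw [Matrix.conjTranspose_apply, fourierCoeff, fourierCoeff, Matrix.of_apply, Matrix.of_apply,
    ← integral_inv_eq_self]
  refine Eq.trans (integral_congr_ae (ae_of_all _ fun g => ?_)) integral_conj
  simp [involution, π.mat_inv]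

theorem trace_mul_fourierCoeff (hf : Integrable f μ) (C : Matrix (Fin π.dim) (Fin π.dim) ℂ) :
    (C * fourierCoeff μ f π).trace = ∫ g, f g * (C * π.mat g⁻¹).trace ∂μ := by
  have h := integral_trace_mul (π.integrable_smul_mat hf measurable_inv) C
  simp only [Matrix.mul_smul, Matrix.trace_smul, smul_eq_mul, Matrix.smul_apply, π.mat_inv] at h ⊢
  exact h.symm

theorem fourierCoeff_comp_mul_left [μ.IsMulLeftInvariant] (hf : Integrable f μ) (h : G) :
    fourierCoeff μ (fun g => f (h * g)) π = fourierCoeff μ f π * π.mat h := by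
  refine Matrix.ext_iff_trace_mul_left.mpr fun C => ?_
  rw [trace_mul_fourierCoeff π (hf.comp_mul_left h), ← Matrix.mul_assoc, Matrix.trace_mul_comm,
    ← Matrix.mul_assoc, trace_mul_fourierCoeff π hf,
    ← integral_mul_left_eq_self (fun g => f g * (π.mat h * C * π.mat g⁻¹).trace) h]
  refine integral_congr_ae (ae_of_all _ fun g => ?_)
  dsimp only
  rw [Matrix.mul_assoc, Matrix.trace_mul_comm (π.mat h), Matrix.mul_assoc, ← π.mat_mul, mul_inv_rev,
    inv_mul_cancel_right]

theorem fourierCoeff_comp_mul_right [μ.IsMulRightInvariant] (hf : Integrable f μ) (h : G) :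
    fourierCoeff μ (fun g => f (g * h)) π = π.mat h * fourierCoeff μ f π := by
  refine Matrix.ext_iff_trace_mul_left.mpr fun C => ?_
  rw [trace_mul_fourierCoeff π (hf.comp_mul_right h), ← Matrix.mul_assoc,
    trace_mul_fourierCoeff π hf,
    ← integral_mul_right_eq_self (fun g => f g * (C * π.mat h * π.mat g⁻¹).trace) h]
  refine integral_congr_ae (ae_of_all _ fun g => ?_)
  dsimp only
  rw [Matrix.mul_assoc, ← π.mat_mul, mul_inv_rev, mul_inv_cancel_left]

theorem trace_mul_fourierCoeff_integral {Y : Type*} [MeasurableSpace Y] {κ : Measure Y} [SFinite κ]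
    [SFinite μ] {F : Y → G → ℂ} (hF : Integrable (Function.uncurry F) (κ.prod μ))
    (C : Matrix (Fin π.dim) (Fin π.dim) ℂ) :
    (C * fourierCoeff μ (fun g => ∫ y, F y g ∂κ) π).trace =
      ∫ y, (C * fourierCoeff μ (F y) π).trace ∂κ :=
  calc (C * fourierCoeff μ (fun g => ∫ y, F y g ∂κ) π).trace
      = ∫ g, ∫ y, F y g * (C * π.mat g⁻¹).trace ∂κ ∂μ := by
        refine (trace_mul_fourierCoeff π hF.integral_prod_right C).trans ?_
        simp only [integral_mul_const, Function.uncurry_apply_pair]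
    _ = ∫ y, ∫ g, F y g * (C * π.mat g⁻¹).trace ∂μ ∂κ :=
        (integral_integral_swap (π.integrable_mul_trace hF measurable_snd.inv C)).symm
    _ = ∫ y, (C * fourierCoeff μ (F y) π).trace ∂κ := integral_congr_ae <| by
        filter_upwards [hF.prod_right_ae] with y hy
        exact (trace_mul_fourierCoeff π hy C).symm

variable [SecondCountableTopology G] [SFinite μ] {H : Subgroup G}
  (ν : Measure H) [IsFiniteMeasure ν]

theorem fourierCoeff_conv [μ.IsMulLeftInvariant] {a b : G → ℂ} (ha : Integrable a μ)
    (hb : Integrable b μ) :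
    fourierCoeff μ (conv μ a b) π = fourierCoeff μ b π * fourierCoeff μ a π := by
  have hF : Integrable (Function.uncurry fun y g => a y * b (y⁻¹ * g)) (μ.prod μ) :=
    (measurePreserving_prod_inv_mul μ μ).integrable_comp_of_integrable (ha.mul_prod hb)
  refine Matrix.ext_iff_trace_mul_left.mpr fun C => ?_
  calc (C * fourierCoeff μ (fun g => ∫ y, a y * b (y⁻¹ * g) ∂μ) π).trace
      = ∫ y, a y * (C * fourierCoeff μ b π * π.mat y⁻¹).trace ∂μ := by
        simp only [trace_mul_fourierCoeff_integral π hF, fourierCoeff_const_mul,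
          fourierCoeff_comp_mul_left π hb, Matrix.mul_smul, Matrix.trace_smul, smul_eq_mul,
          Matrix.mul_assoc]
    _ = (C * (fourierCoeff μ b π * fourierCoeff μ a π)).trace := by
        rw [← trace_mul_fourierCoeff π ha, Matrix.mul_assoc]

/-- The mean `∫_H π(h) dν(h)` of a representation over a subgroup; it is the orthogonal projection
onto the `H`-invariant vectors when `ν` is the normalised Haar measure of `H`. -/
noncomputable def IrrUnitaryRep.mean : Matrix (Fin π.dim) (Fin π.dim) ℂ :=
  Matrix.of fun i j => ∫ h : H, π.mat h i j ∂ν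

omit [IsTopologicalGroup G] [SecondCountableTopology G] in
theorem IrrUnitaryRep.trace_mul_mean (C : Matrix (Fin π.dim) (Fin π.dim) ℂ) :
    (C * π.mean ν).trace = ∫ h : H, (C * π.mat h).trace ∂ν :=
  (integral_trace_mul (fun i j => by
    simpa using π.integrable_smul_mat (integrable_const (1 : ℂ)) measurable_subtype_coe i j)
    C).symm

theorem integrable_comp_subgroup_mul [μ.IsMulLeftInvariant] (hf : Integrable f μ) :
    Integrable (Function.uncurry fun (h : H) g => f (h * g)) (ν.prod μ) := by
  have hshear : MeasurePreserving (fun z : H × G => (z.1, (z.1 : G) * z.2)) (ν.prod μ)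
      (ν.prod μ) :=
    (MeasurePreserving.id ν).skew_product (g := fun (h : H) g => (h : G) * g)
      ((measurable_subtype_coe.comp measurable_fst).mul measurable_snd)
      (ae_of_all _ fun h => map_mul_left_eq_self μ (h : G))
  exact hshear.integrable_comp_of_integrable (hf.comp_snd ν)

theorem integrable_comp_mul_subgroup [μ.IsMulRightInvariant] (hf : Integrable f μ) :
    Integrable (Function.uncurry fun (h : H) g => f (g * h)) (ν.prod μ) := by
  have hshear : MeasurePreserving (fun z : H × G => (z.1, z.2 * (z.1 : G))) (ν.prod μ)
      (ν.prod μ) :=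
    (MeasurePreserving.id ν).skew_product (g := fun (h : H) g => g * (h : G))
      (measurable_snd.mul (measurable_subtype_coe.comp measurable_fst))
      (ae_of_all _ fun h => map_mul_right_eq_self μ (h : G))
  exact hshear.integrable_comp_of_integrable (hf.comp_snd ν)

theorem fourierCoeff_integral_left_translates [μ.IsMulLeftInvariant] (hf : Integrable f μ) :
    fourierCoeff μ (fun g => ∫ h : H, f (h * g) ∂ν) π = fourierCoeff μ f π * π.mean ν := by
  refine Matrix.ext_iff_trace_mul_left.mpr fun C => ?_
  simp only [trace_mul_fourierCoeff_integral π (integrable_comp_subgroup_mul ν hf),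
    fourierCoeff_comp_mul_left π hf, ← Matrix.mul_assoc, π.trace_mul_mean]

theorem fourierCoeff_integral_right_translates [μ.IsMulRightInvariant] (hf : Integrable f μ) :
    fourierCoeff μ (fun g => ∫ h : H, f (g * h) ∂ν) π = π.mean ν * fourierCoeff μ f π := by
  refine Matrix.ext_iff_trace_mul_right.mpr fun C => ?_
  rw [Matrix.trace_mul_comm, trace_mul_fourierCoeff_integral π (integrable_comp_mul_subgroup ν hf),
    Matrix.mul_assoc, Matrix.trace_mul_comm, π.trace_mul_mean]
  refine integral_congr_ae (ae_of_all _ fun h => ?_)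
  dsimp only
  rw [fourierCoeff_comp_mul_right π hf, Matrix.trace_mul_comm, Matrix.mul_assoc,
    Matrix.trace_mul_comm]

theorem fourierCoeff_zonalAverageLift [μ.IsMulLeftInvariant] [μ.IsMulRightInvariant]
    {X : Type*} [MulAction G X] (x₀ : X) (ν : Measure (MulAction.stabilizer G x₀))
    [IsFiniteMeasure ν] (hf : Integrable f μ) :
    fourierCoeff μ (zonalAverageLift x₀ ν f) π = π.mean ν * fourierCoeff μ f π * π.mean ν := by
  have hleft : Integrable (fun g => ∫ h : MulAction.stabilizer G x₀, f (h * g) ∂ν) μ :=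
    (integrable_comp_subgroup_mul ν hf).integral_prod_right
  have hassoc : zonalAverageLift x₀ ν f = fun g => ∫ h₂ : MulAction.stabilizer G x₀,
      ∫ h₁ : MulAction.stabilizer G x₀, f (h₁ * (g * h₂)) ∂ν ∂ν := by
    funext g
    simp only [zonalAverageLift, mul_assoc]
  rw [hassoc, fourierCoeff_integral_right_translates π ν hleft,
    fourierCoeff_integral_left_translates π ν hf, Matrix.mul_assoc]

end FourierCoefficients

theorem integrable_coeFn_Lp_two {Y : Type*} [MeasurableSpace Y] {m : Measure Y} [IsFiniteMeasure m]
    (f : Lp ℂ 2 m) : Integrable f m :=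
  (Lp.memLp f).integrable one_le_two

section Correlation

open DomMulAct (mk)
open MulOpposite (op)

instance opensMeasurableSpace_mulOpposite {M : Type*} [TopologicalSpace M] [MeasurableSpace M]
    [OpensMeasurableSpace M] : OpensMeasurableSpace Mᵐᵒᵖ :=
  ⟨MeasurableSpace.generateFrom_le fun _ hs =>
    (hs.preimage MulOpposite.continuous_op).measurableSet⟩

instance fact_two_ne_top : Fact ((2 : ℝ≥0∞) ≠ ⊤) := ⟨ENNReal.ofNat_ne_top⟩

variable {G : Type*} [Group G] [TopologicalSpace G] [IsTopologicalGroup G] [CompactSpace G]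
  [MeasurableSpace G] [BorelSpace G] {μ : Measure G} [μ.IsHaarMeasure] [IsProbabilityMeasure μ]
  (w f : Lp ℂ 2 μ) (π : IrrUnitaryRep G) (A : Matrix (Fin π.dim) (Fin π.dim) ℂ)

/-- The matrix coefficient `g ↦ tr (π(g) A)` as a continuous function. -/
noncomputable def IrrUnitaryRep.coeff : C(G, ℂ) :=
  ⟨fun g => (π.mat g * A).trace, (π.continuous_mat.matrix_mul continuous_const).matrix_trace⟩

omit [μ.IsHaarMeasure] in
theorem inner_toLp_coeff :
    ⟪f, ContinuousMap.toLp 2 μ ℂ (π.coeff A)⟫_ℂ =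
      ((fourierCoeff μ f π).conjTranspose * A).trace :=
  calc ⟪f, ContinuousMap.toLp 2 μ ℂ (π.coeff A)⟫_ℂ
      = ∫ g, (starRingEnd ℂ) (f g * (A.conjTranspose * π.mat g⁻¹).trace) ∂μ := by
        rw [L2.inner_def]
        refine integral_congr_ae ?_
        filter_upwards [ContinuousMap.coeFn_toLp (𝕜 := ℂ) (p := 2) μ (π.coeff A)] with g hg
        rw [hg, RCLike.inner_apply, map_mul, mul_comm, π.mat_inv, ← Matrix.conjTranspose_mul,
          Matrix.trace_conjTranspose, starRingEnd_apply (star _), star_star]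
        rfl
    _ = ((fourierCoeff μ f π).conjTranspose * A).trace := by
        rw [integral_conj, ← trace_mul_fourierCoeff π (integrable_coeFn_Lp_two f),
          starRingEnd_apply, ← Matrix.trace_conjTranspose, Matrix.conjTranspose_mul,
          Matrix.conjTranspose_conjTranspose]

theorem smul_toLp_coeff (h : G) :
    mk (op h) • ContinuousMap.toLp 2 μ ℂ (π.coeff A) =
      ContinuousMap.toLp 2 μ ℂ (π.coeff (π.mat h * A)) := by
  refine Lp.ext ?_
  filter_upwards [DomMulAct.smul_Lp_ae_eq (mk (op h)) (ContinuousMap.toLp 2 μ ℂ (π.coeff A)),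
    (measurePreserving_mul_right μ h).quasiMeasurePreserving.ae
      (ContinuousMap.coeFn_toLp (𝕜 := ℂ) (p := 2) μ (π.coeff A)),
    ContinuousMap.coeFn_toLp (𝕜 := ℂ) (p := 2) μ (π.coeff (π.mat h * A))] with g h₁ h₂ h₃
  rw [h₁, h₃]
  refine h₂.trans ?_
  simp only [IrrUnitaryRep.coeff, ContinuousMap.coe_mk, π.mat_mul, Matrix.mul_assoc]

variable [SecondCountableTopology G]

variable (μ) in
/-- The correlation `(w, f) ↦ (g ↦ ⟪w (g⁻¹ ·), f⟫)` of two functions in `L²(G)`; the product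
`f • w` on the group itself, as a continuous function. -/
noncomputable def correlation : Lp ℂ 2 μ →L⋆[ℂ] Lp ℂ 2 μ →L[ℂ] C(G, ℂ) :=
  (LinearMap.mk₂'ₛₗ (starRingEnd ℂ) (RingHom.id ℂ)
    (fun (w f : Lp ℂ 2 μ) => (⟨fun g => ⟪mk g⁻¹ • w, f⟫_ℂ, by fun_prop⟩ : C(G, ℂ)))
    (fun w w' f => by ext g; simp [inner_add_left])
    (fun c w f => by ext g; simp [smul_comm _ c, inner_smul_left])
    (fun w f f' => by ext g; simp [inner_add_right])
    (fun c w f => by ext g; simp [inner_smul_right])).mkContinuous₂ 1 fun w f => by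
      rw [one_mul, ContinuousMap.norm_le _ (by positivity)]
      refine fun g => (norm_inner_le_norm (𝕜 := ℂ) (mk g⁻¹ • w) f).trans_eq ?_
      rw [DomMulAct.norm_smul_Lp]

theorem correlation_apply_eq_inner (g : G) :
    correlation μ w f g = ⟪mk g⁻¹ • w, f⟫_ℂ :=
  rfl

theorem correlation_apply (g : G) :
    correlation μ w f g = ∫ k, f k * (starRingEnd ℂ) (w (g⁻¹ * k)) ∂μ := by
  rw [correlation_apply_eq_inner, L2.inner_def]
  refine integral_congr_ae ?_
  filter_upwards [DomMulAct.smul_Lp_ae_eq (mk g⁻¹) w] with k hk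
  rw [hk, RCLike.inner_apply]
  rfl

theorem fourierCoeff_correlation :
    fourierCoeff μ (correlation μ w f) π =
      (fourierCoeff μ w π).conjTranspose * fourierCoeff μ f π := by
  have hconv : ⇑(correlation μ w f) = conv μ f (involution w) := by
    funext g
    simp only [correlation_apply, conv, involution, smul_eq_mul, mul_inv_rev, inv_inv]
  rw [hconv, fourierCoeff_conv π (integrable_coeFn_Lp_two f)
    (integrable_involution (integrable_coeFn_Lp_two w)), fourierCoeff_involution]

theorem correlation_toLp_coeff :
    correlation μ w (ContinuousMap.toLp 2 μ ℂ (π.coeff A)) =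
      π.coeff ((fourierCoeff μ w π).conjTranspose * A) := by
  ext g
  have htranslate : fourierCoeff μ (mk g⁻¹ • w : Lp ℂ 2 μ) π = fourierCoeff μ w π * π.mat g⁻¹ :=
    (fourierCoeff_congr_ae π (DomMulAct.smul_Lp_ae_eq (mk g⁻¹) w)).trans
      (fourierCoeff_comp_mul_left π (integrable_coeFn_Lp_two w) g⁻¹)
  rw [correlation_apply_eq_inner, inner_toLp_coeff, htranslate, π.mat_inv,
    Matrix.conjTranspose_mul, Matrix.conjTranspose_conjTranspose, Matrix.mul_assoc]
  rfl

theorem inner_correlation_correlation_coeff :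
    ⟪ContinuousMap.toLp 2 μ ℂ (correlation μ w f),
        ContinuousMap.toLp 2 μ ℂ (correlation μ w (ContinuousMap.toLp 2 μ ℂ (π.coeff A)))⟫_ℂ =
      (A * (fourierCoeff μ f π).conjTranspose *
        (fourierCoeff μ w π * (fourierCoeff μ w π).conjTranspose)).trace := by
  rw [correlation_toLp_coeff, inner_toLp_coeff,
    fourierCoeff_congr_ae π (ContinuousMap.coeFn_toLp μ _), fourierCoeff_correlation,
    Matrix.conjTranspose_mul, Matrix.conjTranspose_conjTranspose, Matrix.mul_assoc A,
    Matrix.trace_mul_comm A]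
  simp only [Matrix.mul_assoc]

variable {H : Subgroup G} (ν : Measure H)

theorem integrable_right_translates [IsFiniteMeasure ν] :
    Integrable (fun h : H => mk (op (h : G)) • f) ν :=
  (integrable_const ‖f‖).mono' (by fun_prop : Continuous _).aestronglyMeasurable
    (ae_of_all _ fun h => (DomMulAct.norm_smul_Lp _ f).le)

/-- The average `f ↦ ∫_H f (· h) dν(h)` of the right translates of `f` over a subgroup. -/
noncomputable def rightAverage [IsFiniteMeasure ν] : Lp ℂ 2 μ →L[ℂ] Lp ℂ 2 μ :=
  LinearMap.mkContinuous
    { toFun f := ∫ h : H, mk (op (h : G)) • f ∂ν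
      map_add' f f' := by
        simp only [smul_add]
        exact integral_add (integrable_right_translates f ν) (integrable_right_translates f' ν)
      map_smul' c f := by
        simp only [smul_comm _ c f, integral_smul, RingHom.id_apply] }
    (ν.real univ) fun f => by
      rw [mul_comm]
      exact norm_integral_le_of_norm_le_const
        (ae_of_all _ fun h => (DomMulAct.norm_smul_Lp (mk (op (h : G))) f).le)

theorem rightAverage_eq_self [IsProbabilityMeasure ν]
    (hf : ∀ h : H, mk (op (h : G)) • f = f) : rightAverage ν f = f := by
  change ∫ h : H, mk (op (h : G)) • f ∂ν = f
  simp only [hf, integral_const, probReal_univ, one_smul]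

theorem rightAverage_toLp_coeff [IsFiniteMeasure ν] :
    rightAverage ν (ContinuousMap.toLp 2 μ ℂ (π.coeff A)) =
      ContinuousMap.toLp 2 μ ℂ (π.coeff (π.mean ν * A)) := by
  refine ext_inner_left ℂ fun f => ?_
  calc ⟪f, ∫ h : H, mk (op (h : G)) • ContinuousMap.toLp 2 μ ℂ (π.coeff A) ∂ν⟫_ℂ
      = ∫ h : H, (A * (fourierCoeff μ f π).conjTranspose * π.mat h).trace ∂ν := by
        rw [← integral_inner (integrable_right_translates _ ν)]
        simp only [smul_toLp_coeff, inner_toLp_coeff, Matrix.mul_assoc, Matrix.trace_mul_comm A]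
    _ = ⟪f, ContinuousMap.toLp 2 μ ℂ (π.coeff (π.mean ν * A))⟫_ℂ := by
        rw [← π.trace_mul_mean, inner_toLp_coeff, Matrix.mul_assoc, Matrix.trace_mul_comm A,
          Matrix.mul_assoc]

/-- The operators `f ↦ f • w_ρ` on `L²(G)`, one for each scale `ρ`. -/
noncomputable def analysisOperator (w : ℝ → Lp ℂ 2 μ) (ρ : ℝ) : Lp ℂ 2 μ →L[ℂ] Lp ℂ 2 μ :=
  ContinuousMap.toLp 2 μ ℂ ∘L correlation μ (w ρ)

theorem toLp_coeff_mem_weakGramLimit [IsFiniteMeasure ν] {s : Measure ℝ} {w : ℝ → Lp ℂ 2 μ}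
    (hint : ∀ t, 0 < t → ∀ i j, IntegrableOn (fun ρ =>
      (fourierCoeff μ (w ρ) π * (fourierCoeff μ (w ρ) π).conjTranspose) i j) (Ioi t) s)
    (hlim : Tendsto (fun t => Matrix.of fun i j => ∫ ρ in Ioi t,
      (fourierCoeff μ (w ρ) π * (fourierCoeff μ (w ρ) π).conjTranspose) i j ∂s)
      (𝓝[>] 0) (𝓝 (π.mean ν * π.mean ν))) :
    ContinuousMap.toLp 2 μ ℂ (π.coeff A) ∈
      weakGramLimit s (analysisOperator w) (rightAverage ν ∘L rightAverage ν) := by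
  intro f
  set C := A * (fourierCoeff μ f π).conjTranspose
  have hgram : ∀ ρ, ⟪analysisOperator w ρ f,
      analysisOperator w ρ (ContinuousMap.toLp 2 μ ℂ (π.coeff A))⟫_ℂ =
      (C * (fourierCoeff μ (w ρ) π * (fourierCoeff μ (w ρ) π).conjTranspose)).trace :=
    fun ρ => inner_correlation_correlation_coeff (w ρ) f π A
  have htarget : ⟪f, (rightAverage ν ∘L rightAverage ν) (ContinuousMap.toLp 2 μ ℂ (π.coeff A))⟫_ℂ =
      (C * (π.mean ν * π.mean ν)).trace := by
    rw [ContinuousLinearMap.comp_apply, rightAverage_toLp_coeff, rightAverage_toLp_coeff,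
      inner_toLp_coeff, Matrix.mul_assoc A, Matrix.trace_mul_comm A]
    simp only [Matrix.mul_assoc]
  simp only [hgram, htarget]
  refine ⟨fun t ht => integrable_trace_mul (hint t ht) C, ?_⟩
  have htrace : Continuous fun M => (C * M).trace :=
    (continuous_const.matrix_mul continuous_id).matrix_trace
  refine ((htrace.tendsto _).comp hlim).congr' ?_
  filter_upwards [self_mem_nhdsWithin] with t ht
  exact (integral_trace_mul (hint t ht) C).symm

end Correlation

section ScaleMeasure

variable {α : ℝ → ℝ}

instance sigmaFinite_scaleMeasure : SigmaFinite (scaleMeasure α) := by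
  unfold scaleMeasure
  infer_instance

theorem scaleMeasure_restrict_Ioi {t : ℝ} (ht : 0 < t) :
    (scaleMeasure α).restrict (Ioi t) =
      (volume.restrict (Ioi t)).withDensity fun ρ => ENNReal.ofReal (α ρ) := by
  rw [scaleMeasure, restrict_withDensity measurableSet_Ioi,
    Measure.restrict_restrict measurableSet_Ioi, inter_eq_left.mpr (Ioi_subset_Ioi ht.le)]

theorem ae_scaleMeasure_pos : ∀ᵐ ρ ∂scaleMeasure α, 0 < ρ :=
  (withDensity_absolutelyContinuous _ _).ae_le (ae_restrict_mem measurableSet_Ioi)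

theorem toReal_ofReal_smul_ae (hα : ∀ ρ : ℝ, 0 < ρ → 0 ≤ α ρ) (F : ℝ → ℂ) {t : ℝ} (ht : 0 < t) :
    (fun ρ => (ENNReal.ofReal (α ρ)).toReal • F ρ) =ᵐ[volume.restrict (Ioi t)]
      fun ρ => F ρ * (α ρ : ℂ) := by
  filter_upwards [ae_restrict_mem measurableSet_Ioi] with ρ hρ
  rw [ENNReal.toReal_ofReal (hα ρ (ht.trans hρ)), Complex.real_smul, mul_comm]

theorem integrableOn_scaleMeasure_iff (hm : Measurable α) (hα : ∀ ρ : ℝ, 0 < ρ → 0 ≤ α ρ)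
    (F : ℝ → ℂ) {t : ℝ} (ht : 0 < t) :
    IntegrableOn F (Ioi t) (scaleMeasure α) ↔
      IntegrableOn (fun ρ => F ρ * (α ρ : ℂ)) (Ioi t) := by
  rw [IntegrableOn, scaleMeasure_restrict_Ioi ht,
    integrable_withDensity_iff_integrable_smul' hm.ennreal_ofReal
      (ae_of_all _ fun _ => ENNReal.ofReal_lt_top),
    integrable_congr (toReal_ofReal_smul_ae hα F ht), IntegrableOn]

theorem setIntegral_scaleMeasure (hm : Measurable α) (hα : ∀ ρ : ℝ, 0 < ρ → 0 ≤ α ρ)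
    (F : ℝ → ℂ) {t : ℝ} (ht : 0 < t) :
    ∫ ρ in Ioi t, F ρ ∂scaleMeasure α = ∫ ρ in Ioi t, F ρ * (α ρ : ℂ) := by
  rw [scaleMeasure_restrict_Ioi ht, integral_withDensity_eq_integral_toReal_smul
    hm.ennreal_ofReal (ae_of_all _ fun _ => ENNReal.ofReal_lt_top),
    integral_congr_ae (toReal_ofReal_smul_ae hα F ht)]

end ScaleMeasure

theorem isometry_continuousMap_comp {Y Z : Type*} [TopologicalSpace Y] [CompactSpace Y]
    [TopologicalSpace Z] [CompactSpace Z] {q : C(Y, Z)} (hq : Function.Surjective q) :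
    Isometry fun u : C(Z, ℂ) => u.comp q :=
  Isometry.of_dist_eq fun u v => by
    simp only [ContinuousMap.dist_eq_iSup, ContinuousMap.comp_apply]
    exact hq.iSup_comp (g := fun z => dist (u z) (v z))

theorem isOpenQuotientMap_orbit (G : Type*) [Group G] [TopologicalSpace G] [IsTopologicalGroup G]
    [CompactSpace G] {X : Type*} [TopologicalSpace X] [T2Space X] [MulAction G X]
    [ContinuousSMul G X] [MulAction.IsPretransitive G X] (x₀ : X) :
    IsOpenQuotientMap fun g : G => g • x₀ := by
  have hs : Function.Surjective fun g : G => g • x₀ := MulAction.surjective_smul G x₀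
  have hc : Continuous fun g : G => g • x₀ := by fun_prop
  have := hs.compactSpace hc
  exact ⟨hs, hc, isOpenMap_smul_of_sigmaCompact x₀⟩

section HomogeneousSpace

open DomMulAct (mk)
open MulOpposite (op)

variable {G : Type*} [Group G] [TopologicalSpace G] [MeasurableSpace G] [BorelSpace G]
  {X : Type*} [TopologicalSpace X] [MeasurableSpace X] [BorelSpace X] [MulAction G X]
  [ContinuousSMul G X] (x₀ : X) (μ : Measure G)

instance isProbabilityMeasure_invMeasure [IsProbabilityMeasure μ] :
    IsProbabilityMeasure (invMeasure μ x₀) :=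
  Measure.isProbabilityMeasure_map (measurePreserving_orbit μ x₀).measurable.aemeasurable

theorem measurePreserving_smul_invMeasure [IsTopologicalGroup G] [μ.IsMulLeftInvariant] (g : G) :
    MeasurePreserving (fun x : X => g • x) (invMeasure μ x₀) (invMeasure μ x₀) :=
  (measurePreserving_orbit μ x₀).of_semiconj (measurePreserving_mul_left μ g)
    (fun k => mul_smul g k x₀) (measurable_const_smul g)

/-- The lift `φ ↦ φ (· • x₀)` as an isometry `L²(X) → L²(G)`. -/
noncomputable def liftLp : Lp ℂ 2 (invMeasure μ x₀) →ₗᵢ[ℂ] Lp ℂ 2 μ :=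
  Lp.compMeasurePreservingₗᵢ ℂ (fun g : G => g • x₀) (measurePreserving_orbit μ x₀)

theorem coeFn_liftLp (φ : Lp ℂ 2 (invMeasure μ x₀)) : liftLp x₀ μ φ =ᵐ[μ] lift x₀ φ :=
  Lp.coeFn_compMeasurePreserving φ (measurePreserving_orbit μ x₀)

variable [IsTopologicalGroup G]

section Invariance

variable {x₀ μ} [μ.IsMulLeftInvariant]

theorem bullet_mul_stabilizer {ψ : Lp ℂ 2 (invMeasure μ x₀)} (hψ : IsZonal μ x₀ ψ)
    (φ : Lp ℂ 2 (invMeasure μ x₀)) (g : G) {h : G} (hh : h ∈ MulAction.stabilizer G x₀) :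
    bullet μ x₀ φ ψ (g * h) = bullet μ x₀ φ ψ g := by
  refine integral_congr_ae ?_
  filter_upwards [(measurePreserving_smul_invMeasure x₀ μ g⁻¹).quasiMeasurePreserving.ae
    (hψ h⁻¹ (inv_mem hh))] with x hx
  rw [mul_inv_rev, mul_smul, hx]

theorem bullet_eq_of_smul_eq {ψ : Lp ℂ 2 (invMeasure μ x₀)} (hψ : IsZonal μ x₀ ψ)
    (φ : Lp ℂ 2 (invMeasure μ x₀)) {g g' : G} (hg : g' • x₀ = g • x₀) :
    bullet μ x₀ φ ψ g' = bullet μ x₀ φ ψ g := by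
  have hh : g⁻¹ * g' ∈ MulAction.stabilizer G x₀ := by
    rw [MulAction.mem_stabilizer_iff, mul_smul, hg, inv_smul_smul]
  rw [← bullet_mul_stabilizer hψ φ g hh, mul_inv_cancel_left]

theorem waveletTransform_smul [MulAction.IsPretransitive G X]
    {ψ : ℝ → Lp ℂ 2 (invMeasure μ x₀)} {ρ : ℝ} (hψ : IsZonal μ x₀ (ψ ρ))
    (φ : Lp ℂ 2 (invMeasure μ x₀)) (g : G) :
    waveletTransform μ x₀ ψ φ (ρ, g • x₀) = bullet μ x₀ φ (ψ ρ) g :=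
  bullet_eq_of_smul_eq hψ φ (Classical.choose_spec (MulAction.exists_smul_eq G x₀ (g • x₀)))

end Invariance

variable [CompactSpace G] [μ.IsHaarMeasure] [IsProbabilityMeasure μ]

theorem smul_liftLp (φ : Lp ℂ 2 (invMeasure μ x₀)) {h : G}
    (hh : h ∈ MulAction.stabilizer G x₀) : mk (op h) • liftLp x₀ μ φ = liftLp x₀ μ φ := by
  refine Lp.ext ?_
  filter_upwards [DomMulAct.smul_Lp_ae_eq (mk (op h)) (liftLp x₀ μ φ), coeFn_liftLp x₀ μ φ,
    (measurePreserving_mul_right μ h).quasiMeasurePreserving.ae (coeFn_liftLp x₀ μ φ)]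
    with g h₁ h₂ h₃
  rw [h₁, h₂]
  refine h₃.trans ?_
  rw [lift, lift, mul_smul, MulAction.mem_stabilizer_iff.mp hh]

variable [SecondCountableTopology G]

theorem fourierCoeff_lift_selfConv (ψ : Lp ℂ 2 (invMeasure μ x₀)) (π : IrrUnitaryRep G) :
    fourierCoeff μ (lift x₀ (selfConv μ x₀ ψ)) π =
      fourierCoeff μ (liftLp x₀ μ ψ) π * (fourierCoeff μ (liftLp x₀ μ ψ) π).conjTranspose := by
  have hlift : Integrable (lift x₀ ψ : G → ℂ) μ :=
    (integrable_coeFn_Lp_two (liftLp x₀ μ ψ)).congr (coeFn_liftLp x₀ μ ψ)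
  have hconv : (lift x₀ (selfConv μ x₀ ψ) : G → ℂ) =
      conv μ (involution (lift x₀ ψ)) (lift x₀ ψ) := by
    funext g
    simp only [lift, selfConv, conv, smul_eq_mul, mul_smul]
  rw [hconv, fourierCoeff_conv π (integrable_involution hlift) hlift, fourierCoeff_involution,
    fourierCoeff_congr_ae π (coeFn_liftLp x₀ μ ψ)]

theorem bullet_eq_correlation (φ ψ : Lp ℂ 2 (invMeasure μ x₀)) :
    bullet μ x₀ φ ψ = correlation μ (liftLp x₀ μ ψ) (liftLp x₀ μ φ) := by
  funext g
  have hψ : StronglyMeasurable fun x : X => (starRingEnd ℂ) (ψ (g⁻¹ • x)) :=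
    RCLike.continuous_conj.comp_stronglyMeasurable
      ((Lp.stronglyMeasurable ψ).comp_measurable (measurable_const_smul g⁻¹))
  rw [correlation_apply]
  refine (integral_map (measurePreserving_orbit μ x₀).measurable.aemeasurable
    ((Lp.stronglyMeasurable φ).mul hψ).aestronglyMeasurable).trans (integral_congr_ae ?_)
  filter_upwards [coeFn_liftLp x₀ μ φ, (measurePreserving_mul_left μ
    g⁻¹).quasiMeasurePreserving.ae (coeFn_liftLp x₀ μ ψ)] with k h₁ h₂
  rw [h₁, h₂, Pi.mul_apply, lift, lift, mul_smul]

variable {x₀ μ}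

theorem span_coeff_le_weakGramLimit {ν : Measure (MulAction.stabilizer G x₀)} [IsFiniteMeasure ν]
    {S : Set (UnitaryDual G)} {p : ℝ → Lp ℂ 1 μ}
    (hp : ∀ π : IrrUnitaryRep G, π.cls ∈ S →
      Tendsto (fun t => fourierCoeff μ (p t) π) (𝓝[>] 0) (𝓝 1))
    {α : ℝ → ℝ} (hα : Measurable α) (hα_nonneg : ∀ ρ : ℝ, 0 < ρ → 0 ≤ α ρ)
    {ψ : ℝ → Lp ℂ 2 (invMeasure μ x₀)} (hψ : IsZonalWaveletFamily μ x₀ ν S p α ψ) :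
    Submodule.span ℂ {f : Lp ℂ 2 μ | ∃ π : IrrUnitaryRep G, π.cls ∈ S ∧
      ∃ A : Matrix (Fin π.dim) (Fin π.dim) ℂ, (f : G → ℂ) =ᵐ[μ] fun g => (π.mat g * A).trace} ≤
      weakGramLimit (scaleMeasure α) (analysisOperator fun ρ => liftLp x₀ μ (ψ ρ))
        (rightAverage ν ∘L rightAverage ν) := by
  refine Submodule.span_le.mpr ?_
  rintro f ⟨π, hπ, A, hf⟩
  obtain rfl : f = ContinuousMap.toLp 2 μ ℂ (π.coeff A) :=
    Lp.ext (hf.trans (ContinuousMap.coeFn_toLp μ (π.coeff A)).symm)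
  refine toLp_coeff_mem_weakGramLimit π A ν (fun t ht i j => ?_) ?_
  · simpa only [integrableOn_scaleMeasure_iff hα hα_nonneg _ ht, fourierCoeff_lift_selfConv]
      using hψ.integrable t ht π i j
  · have hlim : Tendsto (fun t => π.mean ν * fourierCoeff μ (p t) π * π.mean ν) (𝓝[>] 0)
        (𝓝 (π.mean ν * π.mean ν)) := by
      simpa only [mul_one] using ((hp π hπ).const_mul (π.mean ν)).mul_const (π.mean ν)
    refine hlim.congr' ?_
    filter_upwards [self_mem_nhdsWithin] with t ht
    ext i j
    rw [← fourierCoeff_zonalAverageLift π x₀ ν (L1.integrable_coeFn (p t)),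
      hψ.admissible t ht π hπ i j, Matrix.of_apply, setIntegral_scaleMeasure hα hα_nonneg _ ht]
    simp only [fourierCoeff_lift_selfConv]

variable {s : Measure ℝ} {ψ : ℝ → Lp ℂ 2 (invMeasure μ x₀)}

theorem aestronglyMeasurable_correlation (hψ : AEStronglyMeasurable ψ s) (f : Lp ℂ 2 μ) :
    AEStronglyMeasurable (fun ρ => correlation μ (liftLp x₀ μ (ψ ρ)) f) s :=
  Continuous.comp_aestronglyMeasurable
    (g := fun w => correlation μ (liftLp x₀ μ w) f) (by fun_prop) hψ

theorem aestronglyMeasurable_analysisOperator (hψ : AEStronglyMeasurable ψ s) (f : Lp ℂ 2 μ) :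
    AEStronglyMeasurable (fun ρ => analysisOperator (fun ρ => liftLp x₀ μ (ψ ρ)) ρ f) s :=
  (ContinuousMap.toLp 2 μ ℂ).continuous.comp_aestronglyMeasurable
    (aestronglyMeasurable_correlation hψ f)

variable [MulAction.IsPretransitive G X]

variable (μ x₀) in
/-- The wavelet transform as a linear map. -/
noncomputable def waveletTransformLinear (ψ : ℝ → Lp ℂ 2 (invMeasure μ x₀)) :
    Lp ℂ 2 (invMeasure μ x₀) →ₗ[ℂ] ℝ × X → ℂ where
  toFun φ := waveletTransform μ x₀ ψ φ
  map_add' φ φ' := by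
    funext z
    simp only [waveletTransform, bullet_eq_correlation, map_add, ContinuousMap.add_apply,
      Pi.add_apply]
  map_smul' c φ := by
    funext z
    simp only [waveletTransform, bullet_eq_correlation, map_smul, ContinuousMap.smul_apply,
      Pi.smul_apply, RingHom.id_apply]

variable [T2Space X]

theorem continuous_waveletTransform {ψ : ℝ → Lp ℂ 2 (invMeasure μ x₀)} {ρ : ℝ}
    (hψ : IsZonal μ x₀ (ψ ρ)) (φ : Lp ℂ 2 (invMeasure μ x₀)) :
    Continuous fun x => waveletTransform μ x₀ ψ φ (ρ, x) := by
  refine (isOpenQuotientMap_orbit G x₀).isQuotientMap.continuous_iff.mpr ?_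
  simp only [Function.comp_def, waveletTransform_smul hψ, bullet_eq_correlation]
  exact map_continuous _

theorem aestronglyMeasurable_waveletTransform (hψ : AEStronglyMeasurable ψ s)
    (hz : ∀ᵐ ρ ∂s, IsZonal μ x₀ (ψ ρ)) (φ : Lp ℂ 2 (invMeasure μ x₀)) :
    AEStronglyMeasurable (waveletTransform μ x₀ ψ φ) (s.prod (invMeasure μ x₀)) := by
  classical
  have hq := isOpenQuotientMap_orbit G x₀
  have := hq.surjective.compactSpace hq.continuous
  have := hq.isQuotientMap.secondCountableTopology hq.isOpenMap
  let U : ℝ → C(X, ℂ) := fun ρ =>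
    if h : IsZonal μ x₀ (ψ ρ) then ⟨_, continuous_waveletTransform h φ⟩ else 0
  have hU : ∀ᵐ ρ ∂s, ∀ x, U ρ x = waveletTransform μ x₀ ψ φ (ρ, x) := by
    filter_upwards [hz] with ρ hρ x
    simp only [U, dif_pos hρ, ContinuousMap.coe_mk]
  have hUm : AEStronglyMeasurable U s := by
    rw [← (isometry_continuousMap_comp (q := ⟨_, hq.continuous⟩)
      hq.surjective).isEmbedding.aestronglyMeasurable_comp_iff]
    refine (aestronglyMeasurable_correlation hψ (liftLp x₀ μ φ)).congr ?_
    filter_upwards [hz, hU] with ρ hρ hUρ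
    exact ContinuousMap.ext fun g => calc
      correlation μ (liftLp x₀ μ (ψ ρ)) (liftLp x₀ μ φ) g = bullet μ x₀ φ (ψ ρ) g := by
        rw [bullet_eq_correlation]
      _ = waveletTransform μ x₀ ψ φ (ρ, g • x₀) := (waveletTransform_smul hρ φ g).symm
      _ = U ρ (g • x₀) := (hUρ _).symm
  refine (aestronglyMeasurable_uncurry_continuousMap hUm).congr ?_
  filter_upwards [Measure.quasiMeasurePreserving_fst.ae hU] with z hz using hz z.2

theorem eLpNorm_waveletTransform [SFinite s] (hψ : AEStronglyMeasurable ψ s)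
    (hz : ∀ᵐ ρ ∂s, IsZonal μ x₀ (ψ ρ)) (φ : Lp ℂ 2 (invMeasure μ x₀)) :
    eLpNorm (waveletTransform μ x₀ ψ φ) 2 (s.prod (invMeasure μ x₀)) =
      eLpNorm (fun ρ => analysisOperator (fun ρ => liftLp x₀ μ (ψ ρ)) ρ (liftLp x₀ μ φ)) 2 s := by
  have hmp : MeasurePreserving (Prod.map id fun g : G => g • x₀) (s.prod μ)
      (s.prod (invMeasure μ x₀)) :=
    (MeasurePreserving.id s).prod (measurePreserving_orbit μ x₀)
  refine Eq.trans ?_ (eLpNorm_uncurry_continuousMap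
    (aestronglyMeasurable_correlation hψ (liftLp x₀ μ φ)))
  rw [← eLpNorm_comp_measurePreserving (aestronglyMeasurable_waveletTransform hψ hz φ) hmp]
  refine eLpNorm_congr_ae ?_
  filter_upwards [Measure.quasiMeasurePreserving_fst.ae hz] with z hρ
  rw [← bullet_eq_correlation]
  exact waveletTransform_smul hρ φ z.2

end HomogeneousSpace

end DiffusiveWavelet

open DiffusiveWavelet

theorem theorem4p9_general
    {G : Type*} [Group G] [TopologicalSpace G] [IsTopologicalGroup G] [CompactSpace G]
    [SecondCountableTopology G] [MeasurableSpace G] [BorelSpace G]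
    {X : Type*} [TopologicalSpace X] [T2Space X] [MeasurableSpace X] [BorelSpace X]
    [MulAction G X] [ContinuousSMul G X] [MulAction.IsPretransitive G X] (x₀ : X)
    (μ : Measure G) [μ.IsHaarMeasure] [IsProbabilityMeasure μ]
    (ν : Measure (MulAction.stabilizer G x₀)) [IsProbabilityMeasure ν]
    (S : Set (UnitaryDual G)) (p : ℝ → Lp ℂ 1 μ)
    (hp : ∀ π : IrrUnitaryRep G, π.cls ∈ S →
      Tendsto (fun t => fourierCoeff μ (p t) π) (𝓝[>] 0) (𝓝 1))
    (α : ℝ → ℝ) (hα : Measurable α) (hα_nonneg : ∀ ρ : ℝ, 0 < ρ → 0 ≤ α ρ)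
    (ψ : ℝ → Lp ℂ 2 (invMeasure μ x₀)) (hψ_meas : AEStronglyMeasurable ψ (scaleMeasure α))
    (hψ : IsZonalWaveletFamily μ x₀ ν S p α ψ) :
    (∀ φ : L2ZeroSpace μ x₀ S, ∀ ρ : ℝ, 0 < ρ → ∀ g : G,
      waveletTransform μ x₀ ψ (φ : Lp ℂ 2 (invMeasure μ x₀)) (ρ, g • x₀) =
        bullet μ x₀ (φ : Lp ℂ 2 (invMeasure μ x₀)) (ψ ρ) g) ∧
    ∃ W : L2ZeroSpace μ x₀ S →ₗᵢ[ℂ] Lp ℂ 2 ((scaleMeasure α).prod (invMeasure μ x₀)),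
      ∀ φ : L2ZeroSpace μ x₀ S,
        (W φ : ℝ × X → ℂ) =ᵐ[(scaleMeasure α).prod (invMeasure μ x₀)]
          waveletTransform μ x₀ ψ (φ : Lp ℂ 2 (invMeasure μ x₀)) := by
  have hz : ∀ᵐ ρ ∂scaleMeasure α, IsZonal μ x₀ (ψ ρ) := ae_scaleMeasure_pos.mono hψ.zonal
  refine ⟨fun φ ρ hρ g => waveletTransform_smul (hψ.zonal ρ hρ) φ g,
    exists_linearIsometry_Lp ((waveletTransformLinear x₀ μ ψ).domRestrict (L2ZeroSpace μ x₀ S))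
      (fun φ => aestronglyMeasurable_waveletTransform hψ_meas hz φ) fun φ => ?_⟩
  have hT : (rightAverage ν ∘L rightAverage ν) (liftLp x₀ μ φ) = liftLp x₀ μ φ := by
    have h := rightAverage_eq_self _ ν fun h => smul_liftLp x₀ μ (φ : Lp ℂ 2 _) h.2
    rw [ContinuousLinearMap.comp_apply, h, h]
  calc eLpNorm (waveletTransform μ x₀ ψ (φ : Lp ℂ 2 (invMeasure μ x₀))) 2 _
      = eLpNorm (fun ρ => analysisOperator (fun ρ => liftLp x₀ μ (ψ ρ)) ρ (liftLp x₀ μ φ)) 2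
          (scaleMeasure α) := eLpNorm_waveletTransform hψ_meas hz φ
    _ = ‖liftLp x₀ μ φ‖ₑ := eLpNorm_eq_enorm_of_mem_closure ae_scaleMeasure_pos
          (span_coeff_le_weakGramLimit hp hα hα_nonneg hψ)
          (aestronglyMeasurable_analysisOperator hψ_meas) φ.2 hT
    _ = ‖φ‖ₑ := (liftLp x₀ μ).enorm_map φ

theorem theorem4p9
    {E : Type*} [NormedAddCommGroup E] [NormedSpace ℝ E] [FiniteDimensional ℝ E]
    {G : Type*} [Group G] [TopologicalSpace G] [ChartedSpace E G] [LieGroup 𝓘(ℝ, E) ∞ G]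
    [CompactSpace G] [T2Space G] [MeasurableSpace G] [BorelSpace G]
    {X : Type*} [TopologicalSpace X] [T2Space X] [MeasurableSpace X] [BorelSpace X]
    [MulAction G X] [ContinuousSMul G X] [MulAction.IsPretransitive G X] (x₀ : X)
    (μ : Measure G) [μ.IsHaarMeasure] [IsProbabilityMeasure μ]
    (ν : Measure (MulAction.stabilizer G x₀)) [ν.IsHaarMeasure] [IsProbabilityMeasure ν]
    (S : Set (UnitaryDual G)) (p : ℝ → Lp ℂ 1 μ) (hp : IsDiffusiveApproxIdentity μ S p)
    (α : ℝ → ℝ) (hα : Measurable α) (hα_nonneg : ∀ ρ : ℝ, 0 < ρ → 0 ≤ α ρ)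
    (ψ : ℝ → Lp ℂ 2 (invMeasure μ x₀)) (hψ_meas : AEStronglyMeasurable ψ (scaleMeasure α))
    (hψ : IsZonalWaveletFamily μ x₀ ν S p α ψ) :
    (∀ φ : L2ZeroSpace μ x₀ S, ∀ ρ : ℝ, 0 < ρ → ∀ g : G,
      waveletTransform μ x₀ ψ (φ : Lp ℂ 2 (invMeasure μ x₀)) (ρ, g • x₀) =
        bullet μ x₀ (φ : Lp ℂ 2 (invMeasure μ x₀)) (ψ ρ) g) ∧
    ∃ W : L2ZeroSpace μ x₀ S →ₗᵢ[ℂ] Lp ℂ 2 ((scaleMeasure α).prod (invMeasure μ x₀)),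
      ∀ φ : L2ZeroSpace μ x₀ S,
        (W φ : ℝ × X → ℂ) =ᵐ[(scaleMeasure α).prod (invMeasure μ x₀)]
          waveletTransform μ x₀ ψ (φ : Lp ℂ 2 (invMeasure μ x₀)) := by
  have : IsTopologicalGroup G := topologicalGroup_of_lieGroup 𝓘(ℝ, E) ∞
  have : SecondCountableTopology G := ChartedSpace.secondCountable_of_sigmaCompact E G
  exact theorem4p9_general x₀ μ ν S p (fun π _ => hp.tendsto_one π) α hα hα_nonneg ψ hψ_meas hψ
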